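/- Let $\kappa>0$, let $(\mathcal F_t)_{t\ge0}$ be a filtration on a probability space and let $B=(B_t)_{t\ge 0}$ be a standard one-dimensional Brownian motion with respect to it: $B_0=0$ a.s., $B$ is adapted, has a.s. continuous paths, and for $s\le t$ the increment $B_t-B_s$ is $N(0,t-s)$-distributed and independent of $\mathcal F_s$ (for example, $\mathcal F_t=\sigma(B_s:s\le t)$). For $z\in\mathbb H=\{\operatorname{Im}z>0\}$ let $t\mapsto g_t(z)$ be the solution of $$\partial_t g_t(z)=\frac{2}{g_t(z)-\sqrt\kappa B_t},\qquad g_0(z)=z,$$ up to its lifetime $\tau(z)\in[0,\infty]$, the first time at which $g_t(z)-\sqrt\kappa B_t$ hits zero, and regard $g_t$ as a map with domain $H_t=\{z\in\mathbb H:\tau(z)>t\}$. The family $\{g_t:t\ge0\}$ is called chordal $\mathrm{SLE}_\kappa$ (driven by $B$). Let $\tau$ be a stopping time with respect to $(\mathcal F_t)$ with $\tau<\infty$ almost surely, and put $$\hat g_t(z):=g_{t+\tau}\bigl(g_\tau^{-1}(z+\sqrt\kappa B_\tau)\bigr)-\sqrt\kappa B_\tau ,$$ defined for those $z\in\mathbb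 H$ with $g_\tau^{-1}(z+\sqrt\kappa B_\tau)\in H_{t+\tau}$. Then: 1. $\{\hat g_t:t\ge0\}$ is again a chordal $\mathrm{SLE}_\kappa$: almost surely, it is the family of maps solving the above equation driven by some standard Brownian motion $\hat B$ in place of $B$. 2. The process $(t,z)\mapsto\hat g_t(z)$ has the same distribution as $(t,z)\mapsto g_t(z)$. 3. $\{\hat g_t:t\ge0\}$ is independent of $\{g_t:t\in[0,\tau]\}$, i.e. of $\tau$ together with the stopped process $(g_{t\wedge\tau})_{t\ge0}$. Here a family of partially defined maps is regarded as a random function of $(t,z)$ with an extra value "undefined", with the product $\sigma$-algebra. -/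

import Mathlib

open MeasureTheory ProbabilityTheory
open scoped NNReal ENNReal

/-- The σ-algebra on `Option α = α ⊔ {none}`: a set is measurable iff its part in `α` is.
It serves as the state space of partially defined processes, `none` meaning "undefined". -/
instance optionMeasurableSpace {α : Type*} [m : MeasurableSpace α] :
    MeasurableSpace (Option α) :=
  MeasurableSpace.map some m

/-- `f` solves, on the time interval `[0, T]`, the Loewner equation
`∂ₜ f(t) = 2 / (f(t) - U(t))`, `f(0) = z`, with non-vanishing denominator. -/
def IsLoewnerSolution (U : ℝ≥0 → ℝ) (z : ℂ) (T : ℝ≥0) (f : ℝ → ℂ) : Prop :=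
  f 0 = z ∧ ∀ t ∈ Set.Icc (0 : ℝ) T,
    f t ≠ (U t.toNNReal : ℂ) ∧
    HasDerivWithinAt f (2 / (f t - (U t.toNNReal : ℂ))) (Set.Icc (0 : ℝ) T) t

/-- The lifetime of the point `z` under the Loewner equation driven by `U`, that is, the first
time at which `g_t(z) - U_t` hits zero (`∞` if there is none), expressed as the supremum of the
times up to which the solution exists. -/
noncomputable def loewnerLifetime (U : ℝ≥0 → ℝ) (z : ℂ) : ℝ≥0∞ :=
  ⨆ (T : ℝ≥0) (_ : ∃ f, IsLoewnerSolution U z T f), (T : ℝ≥0∞)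

/-- The domain `H_t` of the Loewner map `g_t`: the points of the open upper half-plane whose
lifetime exceeds `t`. -/
def loewnerDomain (U : ℝ≥0 → ℝ) (t : ℝ≥0) : Set ℂ :=
  {z | 0 < z.im ∧ (t : ℝ≥0∞) < loewnerLifetime U z}

lemma exists_solution_of_mem_loewnerDomain {U : ℝ≥0 → ℝ} {t : ℝ≥0} {z : ℂ}
    (h : z ∈ loewnerDomain U t) : ∃ f, IsLoewnerSolution U z t f := by
  obtain ⟨T, hT⟩ := lt_iSup_iff.1 h.2
  obtain ⟨⟨f, hf⟩, hlt⟩ := lt_iSup_iff.1 hT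
  have hle : (t : ℝ) ≤ T := by exact_mod_cast (ENNReal.coe_lt_coe.1 hlt).le
  have hs : Set.Icc (0 : ℝ) t ⊆ Set.Icc (0 : ℝ) T := Set.Icc_subset_Icc_right hle
  exact ⟨f, hf.1, fun s h0 => ⟨(hf.2 s (hs h0)).1, (hf.2 s (hs h0)).2.mono hs⟩⟩

open Classical in
/-- The Loewner map `g_t` driven by `U`, as a partial function on `ℂ` with domain `H_t`:
`g_t(z)` is the value at time `t` of the solution of the Loewner equation started from `z`. -/
noncomputable def loewnerMap (U : ℝ≥0 → ℝ) (t : ℝ≥0) (z : ℂ) : Option ℂ :=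
  if h : z ∈ loewnerDomain U t then
    some ((exists_solution_of_mem_loewnerDomain h).choose t)
  else none

open Classical in
/-- The inverse of an injective partial function on `ℂ`, defined on its range. -/
noncomputable def partialInverse (φ : ℂ → Option ℂ) (w : ℂ) : Option ℂ :=
  if h : ∃ z, φ z = some w then some h.choose else none

section Flow

variable {Ω : Type*} [mΩ : MeasurableSpace Ω]

/-- `B` is a standard one-dimensional Brownian motion with respect to the filtration `𝓕`. -/
structure IsBrownianWrt (𝓕 : Filtration ℝ≥0 mΩ) (B : ℝ≥0 → Ω → ℝ) (P : Measure Ω) : Prop where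
  isBrownian : IsBrownianReal B P
  adapted : ∀ t, Measurable[𝓕 t] (B t)
  indep_increment : ∀ s t, s ≤ t →
    Indep (MeasurableSpace.comap (fun ω => B t ω - B s ω) inferInstance) (𝓕 s) P

/-- The family of maps `g_t`, `t ≥ 0`, solving the Loewner equation driven by `√κ B`. -/
noncomputable def sleFlow (κ : ℝ) (B : ℝ≥0 → Ω → ℝ) (t : ℝ≥0) (ω : Ω) : ℂ → Option ℂ :=
  loewnerMap (fun s => √κ * B s ω) t

/-- `G` is a chordal SLE_κ in the upper half-plane: almost surely, it is the family of maps
solving the Loewner equation driven by `√κ` times some standard Brownian motion. -/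
def IsChordalSLE (κ : ℝ) (G : ℝ≥0 → Ω → ℂ → Option ℂ) (P : Measure Ω) : Prop :=
  ∃ B : ℝ≥0 → Ω → ℝ, IsBrownianReal B P ∧ ∀ᵐ ω ∂P, ∀ t, G t ω = sleFlow κ B t ω

/-- The process after time `τ`, as a partial function of `z`:
`ĝ_t(z) = g_{t+τ}(g_τ⁻¹(z + √κ B_τ)) - √κ B_τ`.
(The value at sample points with `τ = ∞` is irrelevant.) -/
noncomputable def shiftedSLE (κ : ℝ) (B : ℝ≥0 → Ω → ℝ) (τ : Ω → WithTop ℝ≥0)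
    (t : ℝ≥0) (ω : Ω) (z : ℂ) : Option ℂ :=
  let s : ℝ≥0 := (τ ω).untopD 0
  let x : ℂ := ((√κ * B s ω : ℝ) : ℂ)
  ((partialInverse (sleFlow κ B s ω) (z + x)).bind (sleFlow κ B (t + s) ω)).map (· - x)

/-- The history `{g_t : t ∈ [0, τ]}`: the time `τ` together with the maps stopped at `τ`. -/
noncomputable def sleHistory (κ : ℝ) (B : ℝ≥0 → Ω → ℝ) (τ : Ω → WithTop ℝ≥0) (ω : Ω) :
    WithTop ℝ≥0 × (ℝ≥0 → ℂ → Option ℂ) :=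
  (τ ω, fun t => sleFlow κ B (min t ((τ ω).untopD 0)) ω)

end Flow

/-! The heart is a deterministic flow property, `loewnerMap_shift`: for a continuous driver `U`,
restarting at time `s` and recentring at `U s` gives the Loewner maps driven by `r ↦ U (r + s) - U
s`. With `s = τ` and `U = √κ B`, the restarted flow is the SLE flow of `B (τ + ·) - B τ`. By the
strong Markov property this increment process is a Brownian motion independent of the past of `τ`.
The restarted flow is a measurable functional of it, whereas the history is measurable with respect
to that past, so all three claims follow.

The vector field is singular. It is tamed by raising the imaginary part of its argument to at least
`ε`, which makes it bounded and Lipschitz, so solutions exist globally, forward and backward.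
Imaginary parts decrease along solutions, so a solution that ends at height at least `ε` never felt
the clipping: the Loewner map is recovered from the clipped flows by a condition at the final time
only (`loewnerMap_eq_some_iff_clipped`). Measurability in the driver comes from Euler schemes
converging to the clipped flow; the scheme up to `t` reads the driver only on `[0, t]`, which also
yields adaptedness.

The strong Markov property is proved for stopping times approximated from above on grids.
Exceptional null sets are removed by modifying `B` and `τ` and augmenting the filtration. -/

/-! ### The regularized Loewner equation -/

/-- The point `w` with its imaginary part raised to at least `ε`. -/
noncomputable def imClip (ε : ℝ) (w : ℂ) : ℂ := ⟨w.re, max w.im ε⟩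

/-- The Loewner vector field, regularized so as to be bounded and globally Lipschitz. -/
noncomputable def clippedField (ε : ℝ) (U : ℝ≥0 → ℝ) (t : ℝ) (w : ℂ) : ℂ :=
  2 / (imClip ε w - (U t.toNNReal : ℂ))

/-- `f` solves on `[0, T]` the Loewner equation with the regularized vector field. -/
def IsClippedSolution (ε : ℝ) (U : ℝ≥0 → ℝ) (z : ℂ) (T : ℝ≥0) (f : ℝ → ℂ) : Prop :=
  f 0 = z ∧ ∀ t ∈ Set.Icc (0 : ℝ) T,
    HasDerivWithinAt f (clippedField ε U t (f t)) (Set.Icc (0 : ℝ) T) t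

lemma imClip_of_le {ε : ℝ} {w : ℂ} (h : ε ≤ w.im) : imClip ε w = w :=
  Complex.ext rfl (max_eq_left h)

lemma norm_imClip_sub_imClip_le (ε : ℝ) (w w' : ℂ) :
    ‖imClip ε w - imClip ε w'‖ ≤ ‖w - w'‖ := by
  rw [Complex.norm_def, Complex.norm_def]
  refine Real.sqrt_le_sqrt ?_
  simp only [Complex.normSq_apply, Complex.sub_re, Complex.sub_im, imClip]
  have := abs_max_sub_max_le_abs w.im w'.im ε
  have := mul_self_le_mul_self (abs_nonneg _) this
  rw [abs_mul_abs_self, abs_mul_abs_self] at this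
  linarith

lemma le_norm_imClip_sub (ε : ℝ) (w : ℂ) (x : ℝ) : ε ≤ ‖imClip ε w - (x : ℂ)‖ := by
  refine le_trans ?_ ((le_abs_self _).trans (Complex.abs_im_le_norm _))
  simp [imClip]

lemma imClip_sub_ne_zero {ε : ℝ} (hε : 0 < ε) (w : ℂ) (x : ℝ) : imClip ε w - (x : ℂ) ≠ 0 :=
  norm_pos_iff.1 (hε.trans_le (le_norm_imClip_sub ε w x))

lemma norm_clippedField_le {ε : ℝ} (hε : 0 < ε) (U : ℝ≥0 → ℝ) (t : ℝ) (w : ℂ) :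
    ‖clippedField ε U t w‖ ≤ 2 / ε := by
  rw [clippedField, norm_div, Complex.norm_ofNat]
  gcongr
  exact le_norm_imClip_sub ε w _

lemma lipschitzWith_clippedField {ε : ℝ} (hε : 0 < ε) (U : ℝ≥0 → ℝ) (t : ℝ) :
    LipschitzWith (2 / ε ^ 2).toNNReal (clippedField ε U t) := by
  refine LipschitzWith.of_dist_le_mul fun w w' => ?_
  rw [Real.coe_toNNReal _ (by positivity), dist_eq_norm, dist_eq_norm]
  have h := imClip_sub_ne_zero hε w (U t.toNNReal)
  have h' := imClip_sub_ne_zero hε w' (U t.toNNReal)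
  have e : clippedField ε U t w - clippedField ε U t w' =
      2 * (imClip ε w' - imClip ε w) /
        ((imClip ε w - (U t.toNNReal : ℂ)) * (imClip ε w' - (U t.toNNReal : ℂ))) := by
    rw [clippedField, clippedField]
    field_simp
    ring
  rw [e, norm_div, norm_mul, norm_mul, Complex.norm_ofNat, norm_sub_rev, div_mul_eq_mul_div]
  have := le_norm_imClip_sub ε w (U t.toNNReal)
  have := le_norm_imClip_sub ε w' (U t.toNNReal)
  have := norm_imClip_sub_imClip_le ε w w'
  rw [pow_two]
  gcongr

lemma continuous_imClip (ε : ℝ) : Continuous (imClip ε) :=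
  (LipschitzWith.of_dist_le_mul (K := 1) fun w w' => by
    simpa [dist_eq_norm] using norm_imClip_sub_imClip_le ε w w').continuous

lemma continuous_clippedField {ε : ℝ} (hε : 0 < ε) {U : ℝ≥0 → ℝ} (hU : Continuous U) :
    Continuous fun p : ℝ × ℂ => clippedField ε U p.1 p.2 := by
  refine continuous_const.div ?_ fun p => imClip_sub_ne_zero hε _ _
  have := continuous_imClip ε
  have : Continuous fun t : ℝ => U t.toNNReal := hU.comp continuous_real_toNNReal
  fun_prop

lemma exists_clippedSolution_through {ε : ℝ} (hε : 0 < ε) {U : ℝ≥0 → ℝ} (hU : Continuous U)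
    (z : ℂ) (T : ℝ≥0) {s : ℝ} (hs : s ∈ Set.Icc (0 : ℝ) T) :
    ∃ f, f s = z ∧ IsClippedSolution ε U (f 0) T f := by
  -- The global bound `2 / ε` confines a solution to a ball of radius `2 / ε * T`, so one
  -- application covers all of `[0, T]` from any initial time `s`.
  have hL : IsPicardLindelof (clippedField ε U) (tmin := 0) (tmax := T) ⟨s, hs⟩ z
      ((2 / ε).toNNReal * T) 0 (2 / ε).toNNReal (2 / ε ^ 2).toNNReal := by
    refine ⟨fun t _ => (lipschitzWith_clippedField hε U t).lipschitzOnWith, fun w _ => ?_,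
      fun t _ w _ => ?_, ?_⟩
    · exact ((continuous_clippedField hε hU).comp (Continuous.prodMk_left w)).continuousOn
    · rw [Real.coe_toNNReal _ (by positivity)]
      exact norm_clippedField_le hε U t w
    · rw [NNReal.coe_mul, NNReal.coe_zero, sub_zero, sub_zero]
      refine mul_le_mul_of_nonneg_left (max_le ?_ ?_) (NNReal.coe_nonneg _)
      · exact sub_le_self _ hs.1
      · simpa using hs.2
  obtain ⟨f, hf, h⟩ := hL.exists_eq_forall_mem_Icc_hasDerivWithinAt₀
  exact ⟨f, hf, rfl, h⟩

namespace IsClippedSolution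

variable {ε : ℝ} {U : ℝ≥0 → ℝ} {z : ℂ} {T : ℝ≥0} {f g : ℝ → ℂ}

lemma continuousOn (hf : IsClippedSolution ε U z T f) : ContinuousOn f (Set.Icc 0 T) :=
  fun t ht => (hf.2 t ht).continuousWithinAt

lemma mono (hf : IsClippedSolution ε U z T f) {T' : ℝ≥0} (h : T' ≤ T) :
    IsClippedSolution ε U z T' f := by
  have hs : Set.Icc (0 : ℝ) T' ⊆ Set.Icc (0 : ℝ) T := Set.Icc_subset_Icc_right (by exact_mod_cast h)
  exact ⟨hf.1, fun t ht => (hf.2 t (hs ht)).mono hs⟩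

lemma hasDerivWithinAt_Ici (hf : IsClippedSolution ε U z T f) {t : ℝ}
    (ht : t ∈ Set.Ico (0 : ℝ) T) : HasDerivWithinAt f (clippedField ε U t (f t)) (Set.Ici t) t :=
  (hf.2 t ⟨ht.1, ht.2.le⟩).mono_of_mem_nhdsWithin (Icc_mem_nhdsGE_of_mem ht)

lemma eqOn (hε : 0 < ε) (hf : IsClippedSolution ε U z T f) (hg : IsClippedSolution ε U z T g) :
    Set.EqOn f g (Set.Icc 0 T) :=
  ODE_solution_unique (lipschitzWith_clippedField hε U) hf.continuousOn
    (fun _ ht => hf.hasDerivWithinAt_Ici ht) hg.continuousOn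
    (fun _ ht => hg.hasDerivWithinAt_Ici ht) (hf.1.trans hg.1.symm)

/-- Uniqueness backward in time; this is what makes the Loewner maps injective. -/
lemma eqOn_of_eq_right (hε : 0 < ε) {z' : ℂ} (hf : IsClippedSolution ε U z T f)
    (hg : IsClippedSolution ε U z' T g) (h : f T = g T) : Set.EqOn f g (Set.Icc 0 T) := by
  refine ODE_solution_unique_of_mem_Icc_left (s := fun _ => Set.univ)
    (fun t _ => (lipschitzWith_clippedField hε U t).lipschitzOnWith) hf.continuousOn
    (fun t ht => ?_) (fun _ _ => trivial) hg.continuousOn (fun t ht => ?_) (fun _ _ => trivial) h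
  · exact (hf.2 t ⟨ht.1.le, ht.2⟩).mono_of_mem_nhdsWithin (Icc_mem_nhdsLE_of_mem ht)
  · exact (hg.2 t ⟨ht.1.le, ht.2⟩).mono_of_mem_nhdsWithin (Icc_mem_nhdsLE_of_mem ht)

/-- The clipped denominator has positive imaginary part, so its reciprocal points downward. Hence a
height bound at the final time holds at all earlier times. -/
lemma antitoneOn_im (hε : 0 < ε) (hf : IsClippedSolution ε U z T f) :
    AntitoneOn (fun t => (f t).im) (Set.Icc 0 T) := by
  have hd : ∀ t ∈ Set.Icc (0 : ℝ) T,
      HasDerivWithinAt (fun t => (f t).im) (clippedField ε U t (f t)).im (Set.Icc 0 T) t :=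
    fun t ht => (Complex.imCLM.hasFDerivAt.comp_hasDerivWithinAt t (hf.2 t ht))
  refine antitoneOn_of_hasDerivWithinAt_nonpos (convex_Icc _ _)
    (fun t ht => (hd t ht).continuousWithinAt)
    (fun t ht => (hd t (interior_subset ht)).mono interior_subset) fun t _ => ?_
  have h : 0 ≤ (imClip ε (f t) - (U t.toNNReal : ℂ)).im := by
    simp [imClip, hε.le]
  rw [clippedField, Complex.div_im]
  simp only [Complex.im_ofNat, Complex.re_ofNat, zero_mul, zero_div, zero_sub]
  exact neg_nonpos.2 (div_nonneg (mul_nonneg zero_le_two h) (Complex.normSq_nonneg _))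

lemma isLoewnerSolution (hε : 0 < ε) (hf : IsClippedSolution ε U z T f) (h : ε ≤ (f T).im) :
    IsLoewnerSolution U z T f := by
  refine ⟨hf.1, fun t ht => ?_⟩
  have hle : ε ≤ (f t).im :=
    h.trans (hf.antitoneOn_im hε ht ⟨ht.1.trans ht.2, le_rfl⟩ ht.2)
  refine ⟨fun e => ?_, ?_⟩
  · have := congrArg Complex.im e
    rw [Complex.ofReal_im] at this
    linarith
  · simpa only [clippedField, imClip_of_le hle] using hf.2 t ht

/-- Clipping affects only the imaginary part, hence commutes with the real translation by `U s`. -/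
lemma shift {s t : ℝ≥0} (hf : IsClippedSolution ε U z (t + s) f) :
    IsClippedSolution ε (fun r => U (r + s) - U s) (f s - (U s : ℂ)) t
      (fun r => f (r + s) - (U s : ℂ)) := by
  refine ⟨by simp, fun r hr => ?_⟩
  have hr' : r + s ∈ Set.Icc (0 : ℝ) (t + s : ℝ≥0) := by
    rw [NNReal.coe_add]
    exact ⟨add_nonneg hr.1 s.coe_nonneg, by linarith [hr.2]⟩
  have h := ((hf.2 _ hr').scomp (h := fun r : ℝ => r + s) r
    ((hasDerivWithinAt_id r (Set.Icc (0 : ℝ) t)).add_const (s : ℝ)) fun r hr => by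
      rw [NNReal.coe_add]
      exact ⟨add_nonneg hr.1 s.coe_nonneg, by linarith [hr.2]⟩).sub_const (U s : ℂ)
  rw [one_smul] at h
  refine h.congr_deriv ?_
  have e : (r + s).toNNReal = r.toNNReal + s := by
    rw [Real.toNNReal_add hr.1 s.coe_nonneg, Real.toNNReal_coe]
  simp only [clippedField, e]
  congr 1
  apply Complex.ext <;> simp [imClip]

end IsClippedSolution

lemma exists_clippedSolution {ε : ℝ} (hε : 0 < ε) {U : ℝ≥0 → ℝ} (hU : Continuous U)
    (z : ℂ) (T : ℝ≥0) : ∃ f, IsClippedSolution ε U z T f := by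
  obtain ⟨f, h0, hf⟩ := exists_clippedSolution_through hε hU z T (s := 0) ⟨le_rfl, T.coe_nonneg⟩
  exact ⟨f, h0 ▸ hf⟩

/-! ### Solutions of the Loewner equation -/

namespace IsLoewnerSolution

variable {U : ℝ≥0 → ℝ} {z : ℂ} {T : ℝ≥0} {f g : ℝ → ℂ}

lemma continuousOn (hf : IsLoewnerSolution U z T f) : ContinuousOn f (Set.Icc 0 T) :=
  fun t ht => (hf.2 t ht).2.continuousWithinAt

/-- As `U` is real, the imaginary part `y` solves the linear equation `y' = a y` with `a = -2 / |f -
U|²` bounded on `[0, T]`. A zero of `y` would propagate back to time `0` by uniqueness,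
contradicting `0 < z.im`. -/
lemma im_pos (hU : Continuous U) (hz : 0 < z.im) (hf : IsLoewnerSolution U z T f) {t : ℝ}
    (ht : t ∈ Set.Icc (0 : ℝ) T) : 0 < (f t).im := by
  by_contra! hneg
  have hcont : ContinuousOn (fun t => (f t).im) (Set.Icc 0 T) :=
    Complex.continuous_im.comp_continuousOn hf.continuousOn
  obtain ⟨r, hr, hr0⟩ : ∃ r ∈ Set.Icc 0 t, (f r).im = 0 :=
    intermediate_value_Icc' ht.1 (hcont.mono (Set.Icc_subset_Icc_right ht.2))
      ⟨hneg, by rw [hf.1]; exact hz.le⟩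
  have hsub : Set.Icc 0 r ⊆ Set.Icc (0 : ℝ) T := Set.Icc_subset_Icc_right (hr.2.trans ht.2)
  set a : ℝ → ℝ := fun t => -(2 / Complex.normSq (f t - (U t.toNNReal : ℂ)))
  have ha : ContinuousOn a (Set.Icc 0 T) := by
    refine (continuousOn_const.div (Complex.continuous_normSq.comp_continuousOn
      (hf.continuousOn.sub ?_)) fun t ht => ?_).neg
    · exact (Complex.continuous_ofReal.comp
        (hU.comp continuous_real_toNNReal)).continuousOn
    · exact Complex.normSq_eq_zero.not.2 (sub_ne_zero.2 (hf.2 t ht).1)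
  obtain ⟨M, hM⟩ := isCompact_Icc.exists_bound_of_continuousOn ha
  have hd : ∀ t ∈ Set.Icc (0 : ℝ) T,
      HasDerivWithinAt (fun t => (f t).im) (a t * (f t).im) (Set.Icc 0 T) t := by
    intro t ht
    refine (Complex.imCLM.hasFDerivAt.comp_hasDerivWithinAt t (hf.2 t ht).2).congr_deriv ?_
    simp [a, Complex.div_im]
    ring
  have key := ODE_solution_unique_of_mem_Icc_left (E := ℝ) (v := fun t x => a t * x)
    (s := fun _ => Set.univ) (K := M.toNNReal) (a := 0) (b := r) (f := fun t => (f t).im)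
    (g := fun _ => 0) (fun t ht => LipschitzWith.lipschitzOnWith (LipschitzWith.of_dist_le_mul
      fun x y => ?_)) (hcont.mono hsub) (fun t ht => ?_) (fun _ _ => trivial)
    continuousOn_const (fun t ht => ?_) (fun _ _ => trivial) hr0
  · have := key ⟨le_rfl, hr.1⟩
    simp only [hf.1] at this
    exact hz.ne' this
  · rw [dist_eq_norm, ← mul_sub, norm_mul, dist_eq_norm]
    gcongr
    exact (hM t (hsub ⟨ht.1.le, ht.2⟩)).trans (Real.le_coe_toNNReal _)
  · exact ((hd t (hsub ⟨ht.1.le, ht.2⟩)).mono hsub).mono_of_mem_nhdsWithin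
      (Icc_mem_nhdsLE_of_mem ht)
  · simpa using hasDerivWithinAt_const t (Set.Iic t) (0 : ℝ)

lemma isClippedSolution {ε : ℝ} (hf : IsLoewnerSolution U z T f)
    (h : ∀ t ∈ Set.Icc (0 : ℝ) T, ε ≤ (f t).im) : IsClippedSolution ε U z T f :=
  ⟨hf.1, fun t ht => by
    simpa only [clippedField, imClip_of_le (h t ht)] using (hf.2 t ht).2⟩

lemma exists_lt_im (hU : Continuous U) (hz : 0 < z.im) (hf : IsLoewnerSolution U z T f) :
    ∃ δ > 0, ∀ t ∈ Set.Icc (0 : ℝ) T, δ < (f t).im := by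
  obtain ⟨r, hr, hmin⟩ := isCompact_Icc.exists_isMinOn ⟨0, le_rfl, T.coe_nonneg⟩
    (Complex.continuous_im.comp_continuousOn hf.continuousOn)
  have := hf.im_pos hU hz hr
  exact ⟨(f r).im / 2, by positivity, fun t ht => (half_lt_self this).trans_le (hmin ht)⟩

lemma eqOn (hU : Continuous U) (hz : 0 < z.im) (hf : IsLoewnerSolution U z T f)
    (hg : IsLoewnerSolution U z T g) : Set.EqOn f g (Set.Icc 0 T) := by
  obtain ⟨δ, hδ, hfδ⟩ := hf.exists_lt_im hU hz
  obtain ⟨δ', hδ', hgδ⟩ := hg.exists_lt_im hU hz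
  exact (hf.isClippedSolution fun t ht => (min_le_left δ δ').trans (hfδ t ht).le).eqOn
    (lt_min hδ hδ') (hg.isClippedSolution fun t ht => (min_le_right δ δ').trans (hgδ t ht).le)

/-- Solutions of the Loewner equation live on open time intervals. -/
lemma mem_loewnerDomain (hU : Continuous U) (hz : 0 < z.im) (hf : IsLoewnerSolution U z T f) :
    z ∈ loewnerDomain U T := by
  obtain ⟨δ, hδ, hfδ⟩ := hf.exists_lt_im hU hz
  -- The clipped solution exists past `T`. Its height at `T` is strictly above `δ`, so by continuity
  -- it stays so for a short time, during which it solves the true equation.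
  obtain ⟨g, hg⟩ := exists_clippedSolution hδ hU z (T + 1)
  have hT : (T : ℝ) ∈ Set.Icc (0 : ℝ) T := ⟨T.coe_nonneg, le_rfl⟩
  have hgT : δ < (g T).im := by
    rw [(hg.mono le_self_add).eqOn hδ (hf.isClippedSolution fun t ht => (hfδ t ht).le) hT]
    exact hfδ T hT
  have hT' : (T : ℝ) ∈ Set.Ico (0 : ℝ) (T + 1 : ℝ≥0) := ⟨T.coe_nonneg, by simp⟩
  have hcw : ContinuousWithinAt (fun t => (g t).im) (Set.Ioi (T : ℝ)) T :=
    (Complex.continuous_im.continuousAt.comp_continuousWithinAt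
      (hg.hasDerivWithinAt_Ici hT').continuousWithinAt).mono Set.Ioi_subset_Ici_self
  obtain ⟨S, hSg, hS⟩ := ((hcw.eventually_const_lt hgT).and
    (Ioo_mem_nhdsGT hT'.2)).exists
  lift S to ℝ≥0 using T.2.trans hS.1.le
  refine ⟨hz, lt_of_lt_of_le (ENNReal.coe_lt_coe.2 (NNReal.coe_lt_coe.1 hS.1)) ?_⟩
  exact le_iSup₂_of_le S ⟨g, (hg.mono (NNReal.coe_le_coe.1 hS.2.le)).isLoewnerSolution hδ hSg.le⟩
    le_rfl

end IsLoewnerSolution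

/-! ### The Loewner map and its flow property -/

section LoewnerMap

variable {U : ℝ≥0 → ℝ}

lemma loewnerMap_eq_some_iff (hU : Continuous U) {t : ℝ≥0} {z w : ℂ} :
    loewnerMap U t z = some w ↔ 0 < z.im ∧ ∃ f, IsLoewnerSolution U z t f ∧ f t = w := by
  classical
  rw [loewnerMap]
  constructor
  · intro h
    split_ifs at h with hz
    exact ⟨hz.1, _, (exists_solution_of_mem_loewnerDomain hz).choose_spec, Option.some.inj h⟩
  · rintro ⟨hz, f, hf, rfl⟩
    have hz' := hf.mem_loewnerDomain hU hz
    rw [dif_pos hz']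
    exact congrArg some ((exists_solution_of_mem_loewnerDomain hz').choose_spec.eqOn hU hz hf
      ⟨t.coe_nonneg, le_rfl⟩)

lemma loewnerMap_eq_some_iff_clipped (hU : Continuous U) {t : ℝ≥0} {z w : ℂ} :
    loewnerMap U t z = some w ↔
      ∃ δ > 0, ∃ f, IsClippedSolution δ U z t f ∧ δ ≤ (f t).im ∧ f t = w := by
  rw [loewnerMap_eq_some_iff hU]
  constructor
  · rintro ⟨hz, f, hf, rfl⟩
    obtain ⟨δ, hδ, hfδ⟩ := hf.exists_lt_im hU hz
    exact ⟨δ, hδ, f, hf.isClippedSolution fun t ht => (hfδ t ht).le, (hfδ t ⟨t.coe_nonneg, le_rfl⟩).le, rfl⟩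
  · rintro ⟨δ, hδ, f, hf, hle, rfl⟩
    refine ⟨?_, f, hf.isLoewnerSolution hδ hle, rfl⟩
    rw [← hf.1]
    exact (hδ.trans_le hle).trans_le (hf.antitoneOn_im hδ ⟨le_rfl, t.coe_nonneg⟩ ⟨t.coe_nonneg, le_rfl⟩ t.coe_nonneg)

/-- The clipping level may be changed freely below the final height; this allows two solutions to be
compared at a common level. -/
lemma IsClippedSolution.of_le {ε δ : ℝ} {z : ℂ} {T : ℝ≥0} {f : ℝ → ℂ} (hδ : 0 < δ)
    (hf : IsClippedSolution δ U z T f) (hfT : δ ≤ (f T).im) (h : ε ≤ (f T).im) :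
    IsClippedSolution ε U z T f :=
  (hf.isLoewnerSolution hδ hfT).isClippedSolution fun _ ht =>
    h.trans (hf.antitoneOn_im hδ ht ⟨ht.1.trans ht.2, le_rfl⟩ ht.2)

lemma loewnerMap_injective (hU : Continuous U) {t : ℝ≥0} {z z' w : ℂ}
    (h : loewnerMap U t z = some w) (h' : loewnerMap U t z' = some w) : z = z' := by
  obtain ⟨δ, hδ, f, hf, hfδ, rfl⟩ := (loewnerMap_eq_some_iff_clipped hU).1 h
  obtain ⟨δ', hδ', g, hg, hgδ, e⟩ := (loewnerMap_eq_some_iff_clipped hU).1 h'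
  have h0 := hf.eqOn_of_eq_right hδ (hg.of_le hδ' hgδ (hfδ.trans_eq (by rw [e]))) e.symm
    ⟨le_rfl, t.coe_nonneg⟩
  rw [← hf.1, ← hg.1, h0]

lemma partialInverse_loewnerMap (hU : Continuous U) {t : ℝ≥0} {z w : ℂ} :
    partialInverse (loewnerMap U t) w = some z ↔ loewnerMap U t z = some w := by
  classical
  rw [partialInverse]
  constructor
  · intro h
    split_ifs at h with he
    rw [← Option.some.inj h]
    exact he.choose_spec
  · intro h
    have he : ∃ z, loewnerMap U t z = some w := ⟨z, h⟩
    rw [dif_pos he, loewnerMap_injective hU he.choose_spec h]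

/-- The flow property of the Loewner equation. -/
theorem loewnerMap_shift (hU : Continuous U) (s t : ℝ≥0) (z : ℂ) :
    ((partialInverse (loewnerMap U s) (z + (U s : ℂ))).bind (loewnerMap U (t + s))).map
      (· - (U s : ℂ)) = loewnerMap (fun r => U (r + s) - U s) t z := by
  have hV : Continuous fun r => U (r + s) - U s := by fun_prop
  have hs : (s : ℝ) ∈ Set.Icc (0 : ℝ) (t + s : ℝ≥0) := ⟨s.coe_nonneg, by simp⟩
  ext w
  simp only [Option.map_eq_some_iff, Option.bind_eq_some_iff, partialInverse_loewnerMap hU]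
  constructor
  · rintro ⟨w', ⟨ζ, h1, h2⟩, rfl⟩
    obtain ⟨δ, hδ, f, hf, hfδ, rfl⟩ := (loewnerMap_eq_some_iff_clipped hU).1 h2
    have hfs : δ ≤ (f s).im :=
      hfδ.trans (hf.antitoneOn_im hδ hs ⟨(t + s).coe_nonneg, le_rfl⟩ hs.2)
    have h3 := (loewnerMap_eq_some_iff_clipped hU).2
      ⟨δ, hδ, f, hf.mono le_add_self, hfs, rfl⟩
    have e : f s = z + (U s : ℂ) := Option.some.inj (h3.symm.trans h1)
    refine (loewnerMap_eq_some_iff_clipped hV).2 ⟨δ, hδ, fun r => f (r + s) - (U s : ℂ), ?_, ?_, ?_⟩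
    · simpa [e] using hf.shift
    · simpa using hfδ
    · simp
  · intro h
    obtain ⟨δ, hδ, g, hg, hgδ, rfl⟩ := (loewnerMap_eq_some_iff_clipped hV).1 h
    have hz : δ ≤ z.im := by
      rw [← hg.1]
      exact hgδ.trans (hg.antitoneOn_im hδ ⟨le_rfl, t.coe_nonneg⟩ ⟨t.coe_nonneg, le_rfl⟩ t.coe_nonneg)
    -- The condition is imposed at the intermediate time `s`: running backward gives the preimage `f
    -- 0` under the map at time `s`, running forward matches `g` by uniqueness.
    obtain ⟨f, hfs, hf⟩ := exists_clippedSolution_through hδ hU (z + (U s : ℂ)) (t + s) hs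
    have hsh := hf.shift
    rw [hfs, add_sub_cancel_right] at hsh
    have e := hsh.eqOn hδ hg ⟨t.coe_nonneg, le_rfl⟩
    simp only at e
    have e' : f (t + s : ℝ≥0) = g t + (U s : ℂ) := by
      rw [← e, NNReal.coe_add, sub_add_cancel]
    refine ⟨g t + (U s : ℂ), ⟨f 0, ?_, ?_⟩, by simp⟩
    · exact (loewnerMap_eq_some_iff_clipped hU).2
        ⟨δ, hδ, f, hf.mono le_add_self, by rw [hfs]; simpa using hz, hfs⟩
    · exact (loewnerMap_eq_some_iff_clipped hU).2
        ⟨δ, hδ, f, hf, by rw [e']; simpa using hgδ, e'⟩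

end LoewnerMap

/-! ### Convergence of the Euler scheme -/

open Filter Topology

open Classical in
/-- The value at time `t` of the solution of the regularized Loewner equation. -/
noncomputable def clippedFlow (ε : ℝ) (U : ℝ≥0 → ℝ) (z : ℂ) (t : ℝ≥0) : ℂ :=
  if h : ∃ f, IsClippedSolution ε U z t f then h.choose t else 0

/-- The Euler scheme with step `h` for the regularized Loewner equation. -/
noncomputable def eulerScheme (ε : ℝ) (U : ℝ≥0 → ℝ) (z : ℂ) (h : ℝ) : ℕ → ℂ
  | 0 => z
  | k + 1 => eulerScheme ε U z h k + h • clippedField ε U (k * h) (eulerScheme ε U z h k)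

lemma IsClippedSolution.clippedFlow_eq {ε : ℝ} (hε : 0 < ε) {U : ℝ≥0 → ℝ} {z : ℂ} {T : ℝ≥0}
    {f : ℝ → ℂ} (hf : IsClippedSolution ε U z T f) {t : ℝ≥0} (ht : t ≤ T) :
    clippedFlow ε U z t = f t := by
  have h : ∃ f, IsClippedSolution ε U z t f := ⟨f, hf.mono ht⟩
  rw [clippedFlow, dif_pos h]
  exact h.choose_spec.eqOn hε (hf.mono ht) ⟨t.coe_nonneg, le_rfl⟩

lemma continuous_clippedFlow {ε : ℝ} (hε : 0 < ε) {U : ℝ≥0 → ℝ} (hU : Continuous U) (z : ℂ) :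
    Continuous (clippedFlow ε U z) := by
  refine continuous_iff_continuousAt.2 fun t => ?_
  obtain ⟨f, hf⟩ := exists_clippedSolution hε hU z (t + 1)
  have h : ContinuousOn (clippedFlow ε U z) (Set.Iio (t + 1)) := by
    refine ContinuousOn.congr (f := fun s : ℝ≥0 => f s) ?_ fun s hs => hf.clippedFlow_eq hε hs.le
    exact hf.continuousOn.comp NNReal.continuous_coe.continuousOn
      fun s hs => ⟨s.coe_nonneg, NNReal.coe_le_coe.2 (le_of_lt hs)⟩
  exact h.continuousAt (Iio_mem_nhds (lt_add_one t))

/-- Restricting to levels `1 / (n + 1)` leaves countably many conditions, as measurability requires.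
-/
lemma loewnerMap_eq_some_iff_clippedFlow {U : ℝ≥0 → ℝ} (hU : Continuous U) {t : ℝ≥0} {z w : ℂ} :
    loewnerMap U t z = some w ↔ ∃ n : ℕ,
      1 / ((n : ℝ) + 1) ≤ (clippedFlow (1 / ((n : ℝ) + 1)) U z t).im ∧
        clippedFlow (1 / ((n : ℝ) + 1)) U z t = w := by
  rw [loewnerMap_eq_some_iff_clipped hU]
  constructor
  · rintro ⟨δ, hδ, f, hf, hle, rfl⟩
    obtain ⟨n, hn⟩ := exists_nat_one_div_lt hδ
    have e := (hf.of_le hδ hle (hn.le.trans hle)).clippedFlow_eq Nat.one_div_pos_of_nat le_rfl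
    exact ⟨n, by rw [e]; exact hn.le.trans hle, e⟩
  · rintro ⟨n, hn, rfl⟩
    have hpos : 0 < 1 / ((n : ℝ) + 1) := Nat.one_div_pos_of_nat
    obtain ⟨f, hf⟩ := exists_clippedSolution hpos hU z t
    rw [hf.clippedFlow_eq hpos le_rfl] at hn ⊢
    exact ⟨_, hpos, f, hf, hn, rfl⟩

/-- Discrete Grönwall estimate. The driver is merely continuous, so the one-step error is controlled
by the oscillation `η` of the field along the exact solution instead of a second derivative. -/
lemma norm_eulerScheme_sub_le {ε : ℝ} (hε : 0 < ε) {U : ℝ≥0 → ℝ} {z : ℂ} {T : ℝ≥0} {f : ℝ → ℂ}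
    (hf : IsClippedSolution ε U z T f) {h η : ℝ} (hh : 0 ≤ h) (hη : 0 ≤ η)
    (hmod : ∀ s ∈ Set.Icc (0 : ℝ) T, ∀ r ∈ Set.Icc (0 : ℝ) T, |s - r| ≤ h →
      ‖clippedField ε U s (f s) - clippedField ε U r (f r)‖ ≤ η) (k : ℕ) (hk : k * h ≤ T) :
    ‖eulerScheme ε U z h k - f (k * h)‖ ≤ k * h * η * (1 + 2 / ε ^ 2 * h) ^ k := by
  induction k with
  | zero => simp [eulerScheme, hf.1]
  | succ k ih =>
    push_cast at hk ⊢
    have hk0 : 0 ≤ k * h := by positivity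
    have hk' : k * h ≤ T := by linarith
    have ih := ih hk'
    set K := 2 / ε ^ 2
    have hK : 0 ≤ K := by positivity
    set a := k * h
    have hab : (k + 1 : ℝ) * h = a + h := by simp only [a]; ring
    rw [hab] at hk ⊢
    have ha : a ∈ Set.Icc (0 : ℝ) T := ⟨hk0, hk'⟩
    have hsub : Set.Icc a (a + h) ⊆ Set.Icc (0 : ℝ) T := Set.Icc_subset_Icc hk0 hk
    have hloc : ‖f (a + h) - f a - h • clippedField ε U a (f a)‖ ≤ η * h := by
      have := (convex_Icc a (a + h)).norm_image_sub_le_of_norm_hasDerivWithin_le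
        (f := fun s => f s - s • clippedField ε U a (f a))
        (f' := fun s => clippedField ε U s (f s) - clippedField ε U a (f a)) (C := η)
        (fun s hs =>
          (((hf.2 s (hsub hs)).mono hsub).sub
            ((hasDerivWithinAt_id s (Set.Icc a (a + h))).smul_const
              (clippedField ε U a (f a)))).congr_deriv (by rw [one_smul]))
        (fun s hs => hmod s (hsub hs) a ha (by
          rw [abs_of_nonneg (by linarith [hs.1])]; linarith [hs.2]))
        (Set.left_mem_Icc.2 (by linarith)) (Set.right_mem_Icc.2 (by linarith))
      rw [add_sub_cancel_left, Real.norm_of_nonneg hh] at this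
      refine le_trans (le_of_eq ?_) this
      congr 1
      rw [add_smul]
      abel
    have hlip := (lipschitzWith_clippedField hε U a).norm_sub_le (eulerScheme ε U z h k) (f a)
    rw [Real.coe_toNNReal _ hK] at hlip
    have e : eulerScheme ε U z h (k + 1) - f (a + h) = (eulerScheme ε U z h k - f a) +
        h • (clippedField ε U a (eulerScheme ε U z h k) - clippedField ε U a (f a)) -
        (f (a + h) - f a - h • clippedField ε U a (f a)) := by
      rw [eulerScheme, smul_sub]
      abel
    have hp : 1 ≤ (1 + K * h) ^ (k + 1) := one_le_pow₀ (by nlinarith)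
    calc _ ≤ ‖eulerScheme ε U z h k - f a‖ + h * (K * ‖eulerScheme ε U z h k - f a‖) + η * h := by
          rw [e]
          refine (norm_sub_le _ _).trans (add_le_add ((norm_add_le _ _).trans ?_) hloc)
          rw [norm_smul, Real.norm_of_nonneg hh]
          gcongr
      _ = (1 + K * h) * ‖eulerScheme ε U z h k - f a‖ + h * η := by ring
      _ ≤ (1 + K * h) * (a * η * (1 + K * h) ^ k) + h * η * (1 + K * h) ^ (k + 1) := by
          refine add_le_add (mul_le_mul_of_nonneg_left ih (by positivity)) ?_
          exact le_mul_of_one_le_right (mul_nonneg hh hη) hp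
      _ = (a + h) * η * (1 + K * h) ^ (k + 1) := by ring

lemma tendsto_eulerScheme {ε : ℝ} (hε : 0 < ε) {U : ℝ≥0 → ℝ} (hU : Continuous U) (z : ℂ)
    (t : ℝ≥0) : Tendsto (fun m : ℕ => eulerScheme ε U z (t / (m + 1)) (m + 1)) atTop
      (𝓝 (clippedFlow ε U z t)) := by
  obtain ⟨f, hf⟩ := exists_clippedSolution hε hU z t
  rw [hf.clippedFlow_eq hε le_rfl, Metric.tendsto_atTop]
  intro δ hδ
  -- The total error is at most `C * η`, because `(1 + K h) ^ k ≤ exp (K t)` when `k * h = t`, with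
  -- `K = 2 / ε ^ 2`. The choice `η = δ / (C + 1)` makes it less than `δ`, even for `C = 0`.
  obtain ⟨C, hC⟩ : ∃ C, C = t * Real.exp (2 / ε ^ 2 * t) := ⟨_, rfl⟩
  have hC0 : 0 ≤ C := by rw [hC]; positivity
  have hη : 0 < δ / (C + 1) := by positivity
  have huc : UniformContinuousOn (fun s => clippedField ε U s (f s)) (Set.Icc (0 : ℝ) t) :=
    isCompact_Icc.uniformContinuousOn_of_continuous
      ((continuous_clippedField hε hU).comp_continuousOn (f := fun s : ℝ => (s, f s))
        (continuousOn_id.prodMk hf.continuousOn))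
  obtain ⟨ρ, hρ, hmod⟩ := Metric.uniformContinuousOn_iff.1 huc _ hη
  obtain ⟨N, hN⟩ := exists_nat_gt ((t : ℝ) / ρ)
  refine ⟨N, fun m hm => ?_⟩
  have hm0 : (0 : ℝ) < m + 1 := by positivity
  have hmt : ((m + 1 : ℕ) : ℝ) * (t / (m + 1)) = t := by
    push_cast
    field_simp
  have hstep : (t : ℝ) / (m + 1) < ρ := by
    rw [div_lt_iff₀ hρ] at hN
    rw [div_lt_iff₀ hm0, mul_comm]
    have : (N : ℝ) ≤ m + 1 := by exact_mod_cast hm.trans m.le_succ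
    exact hN.trans_le (mul_le_mul_of_nonneg_right this hρ.le)
  have hh : 0 ≤ (t : ℝ) / (m + 1) := by positivity
  generalize (t : ℝ) / (m + 1) = h at hmt hstep hh ⊢
  generalize m + 1 = k at hmt ⊢
  have h1 := norm_eulerScheme_sub_le hε hf hh hη.le (fun s hs r hr hsr => by
      have := hmod s hs r hr (lt_of_le_of_lt hsr hstep)
      rw [dist_eq_norm] at this
      exact this.le) k hmt.le
  rw [hmt] at h1
  rw [dist_eq_norm]
  refine h1.trans_lt ?_
  have hpow : (1 + 2 / ε ^ 2 * h) ^ k ≤ Real.exp (2 / ε ^ 2 * t) := by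
    calc _ ≤ Real.exp (2 / ε ^ 2 * h) ^ k := by
          refine pow_le_pow_left₀ (by positivity) ?_ k
          rw [add_comm]
          exact Real.add_one_le_exp _
      _ = Real.exp (2 / ε ^ 2 * t) := by
          rw [← Real.exp_nat_mul, mul_left_comm, hmt]
  calc _ ≤ t * (δ / (C + 1)) * Real.exp (2 / ε ^ 2 * t) :=
        mul_le_mul_of_nonneg_left hpow (by positivity)
    _ = C * (δ / (C + 1)) := by rw [hC]; ring
    _ < (C + 1) * (δ / (C + 1)) := by gcongr; linarith
    _ = δ := mul_div_cancel₀ _ (by positivity)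

/-! ### Measurability of the flow in the driver -/

section Measurability

variable {Ω : Type*} {m : MeasurableSpace Ω} {X : ℝ≥0 → Ω → ℝ}

/-- Only the variables `X s` with `s ≤ t` need be measurable, since the Euler nodes lie in `[0, t]`;
applied with the σ-algebra at time `t`, this gives adaptedness. -/
lemma measurable_clippedFlow (hc : ∀ ω, Continuous (X · ω)) {t : ℝ≥0}
    (hX : ∀ s ≤ t, Measurable (X s)) {ε : ℝ} (hε : 0 < ε) (z : ℂ) :
    Measurable fun ω => clippedFlow ε (X · ω) z t := by
  refine measurable_of_tendsto_metrizable (f := fun (n : ℕ) ω =>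
    eulerScheme ε (X · ω) z (t / (n + 1)) (n + 1)) (fun n => ?_)
    (tendsto_pi_nhds.2 fun ω => tendsto_eulerScheme hε (hc ω) z t)
  suffices ∀ k ≤ n + 1, Measurable fun ω => eulerScheme ε (X · ω) z (t / (n + 1)) k from
    this _ le_rfl
  intro k
  induction k with
  | zero => exact fun _ => measurable_const
  | succ k ih =>
    intro hk
    have ih := ih (by omega)
    have hs : ((k : ℝ) * (t / (n + 1))).toNNReal ≤ t := by
      rw [Real.toNNReal_le_iff_le_coe, mul_div_left_comm]
      refine mul_le_of_le_one_right t.coe_nonneg ?_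
      rw [div_le_one (by positivity)]
      exact_mod_cast (by omega : k ≤ n + 1)
    have hv : Measurable fun ω => clippedField ε (X · ω) (k * (t / (n + 1)))
        (eulerScheme ε (X · ω) z (t / (n + 1)) k) :=
      measurable_const.div (((continuous_imClip ε).measurable.comp ih).sub
        (Complex.measurable_ofReal.comp (hX _ hs)))
    exact ih.add (hv.const_smul ((t : ℝ) / (n + 1)))

/-- `L` is defined exactly on the union of the `C n`. The hypothesis forces the candidates `R n` to
agree on overlaps, so any of them may be used there. -/
lemma measurable_option_of_eq_some_iff {α : Type*} [MeasurableSpace α] {L : Ω → Option α}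
    {R : ℕ → Ω → α} {C : ℕ → Set Ω} (hR : ∀ n, Measurable (R n)) (hC : ∀ n, MeasurableSet (C n))
    (h : ∀ ω w, L ω = some w ↔ ∃ n, ω ∈ C n ∧ R n ω = w) : Measurable L := by
  intro S hS
  have hS' : MeasurableSet (some ⁻¹' S) := hS
  have hsome : MeasurableSet (⋃ n, C n ∩ R n ⁻¹' (some ⁻¹' S)) :=
    MeasurableSet.iUnion fun n => (hC n).inter (hR n hS')
  have hnone : MeasurableSet (⋃ n, C n)ᶜ := (MeasurableSet.iUnion hC).compl
  have e1 : ∀ ω, ω ∈ (⋃ n, C n) → (L ω ∈ S ↔ ω ∈ ⋃ n, C n ∩ R n ⁻¹' (some ⁻¹' S)) := by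
    intro ω hω
    obtain ⟨n, hn⟩ := Set.mem_iUnion.1 hω
    have hL := (h ω _).2 ⟨n, hn, rfl⟩
    constructor
    · intro hS
      rw [hL] at hS
      exact Set.mem_iUnion.2 ⟨n, hn, hS⟩
    · intro hω
      obtain ⟨k, hk, hkS⟩ := Set.mem_iUnion.1 hω
      rw [(h ω _).2 ⟨k, hk, rfl⟩]
      exact hkS
  have e2 : ∀ ω, ω ∉ (⋃ n, C n) → L ω = none := by
    intro ω hω
    refine Option.eq_none_iff_forall_ne_some.2 fun w hw => hω ?_
    obtain ⟨n, hn, -⟩ := (h ω w).1 hw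
    exact Set.mem_iUnion.2 ⟨n, hn⟩
  have e3 : (⋃ n, C n ∩ R n ⁻¹' (some ⁻¹' S)) ⊆ ⋃ n, C n :=
    Set.iUnion_mono fun n => Set.inter_subset_left
  by_cases hn : none ∈ S
  · convert hsome.union hnone using 1
    ext ω
    by_cases hω : ω ∈ ⋃ n, C n
    · exact (e1 ω hω).trans ⟨Or.inl, fun h => h.resolve_right fun h => h hω⟩
    · simp only [Set.mem_preimage, e2 ω hω, hn, true_iff]
      exact Or.inr hω
  · convert hsome using 1
    ext ω
    by_cases hω : ω ∈ ⋃ n, C n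
    · exact e1 ω hω
    · simp only [Set.mem_preimage, e2 ω hω, hn, false_iff]
      exact fun h => hω (e3 h)

lemma measurable_loewnerMap_of_clippedFlow (hc : ∀ ω, Continuous (X · ω)) {T : Ω → ℝ≥0} {z : ℂ}
    (h : ∀ ε > 0, Measurable fun ω => clippedFlow ε (X · ω) z (T ω)) :
    Measurable fun ω => loewnerMap (X · ω) (T ω) z := by
  have hn (n : ℕ) := h (1 / ((n : ℝ) + 1)) Nat.one_div_pos_of_nat
  refine measurable_option_of_eq_some_iff hn (C := fun n => {ω |
    1 / ((n : ℝ) + 1) ≤ (clippedFlow (1 / ((n : ℝ) + 1)) (X · ω) z (T ω)).im}) (fun n => ?_)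
    fun ω w => loewnerMap_eq_some_iff_clippedFlow (hc ω)
  exact measurableSet_le measurable_const (Complex.measurable_im.comp (hn n))

lemma measurable_loewnerMap (hc : ∀ ω, Continuous (X · ω)) (hX : ∀ s, Measurable (X s))
    (t : ℝ≥0) (z : ℂ) : Measurable fun ω => loewnerMap (X · ω) t z :=
  measurable_loewnerMap_of_clippedFlow hc fun _ hε =>
    measurable_clippedFlow hc (fun s _ => hX s) hε z

end Measurability

/-! ### The strong Markov property of Brownian motion -/

section StrongMarkov

variable {Ω : Type*} {mΩ : MeasurableSpace Ω} {P : Measure Ω} {𝓖 : Filtration ℝ≥0 mΩ}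
  {X : ℝ≥0 → Ω → ℝ}

/-- `X` is adapted to `𝓖` and its increments over `[s, s + h]` are independent of `𝓖 s`, with law
`N(0, h)`. -/
structure HasGaussianIncrementsWrt (𝓖 : Filtration ℝ≥0 mΩ) (X : ℝ≥0 → Ω → ℝ) (P : Measure Ω) :
    Prop where
  measurable : ∀ t, Measurable[𝓖 t] (X t)
  measure_inter : ∀ s h C S, MeasurableSet[𝓖 s] C → MeasurableSet S →
    P (C ∩ (fun ω => X (s + h) ω - X s ω) ⁻¹' S) = P C * gaussianReal 0 h S

namespace HasGaussianIncrementsWrt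

lemma measurable' (hX : HasGaussianIncrementsWrt 𝓖 X P) (t : ℝ≥0) : Measurable (X t) :=
  (hX.measurable t).mono (𝓖.le t) le_rfl

lemma measure_preimage [IsProbabilityMeasure P] (hX : HasGaussianIncrementsWrt 𝓖 X P)
    (s h : ℝ≥0) {S : Set ℝ} (hS : MeasurableSet S) :
    P ((fun ω => X (s + h) ω - X s ω) ⁻¹' S) = gaussianReal 0 h S := by
  simpa using hX.measure_inter s h Set.univ S MeasurableSet.univ hS

/-- Induction peels off the latest increment: the earlier ones generate an event known at its
starting time. -/
lemma hasIndepIncrements [IsProbabilityMeasure P] (hX : HasGaussianIncrementsWrt 𝓖 X P) :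
    HasIndepIncrements X P := by
  refine .of_nat fun t ht _ => iIndepFun_iff_measure_inter_preimage_eq_mul.2 fun S => ?_
  induction S using Finset.induction_on_max with
  | empty => simp
  | insert a S ha ih =>
    intro sets hs
    have e : t (a + 1) = t a + (t (a + 1) - t a) := (add_tsub_cancel_of_le (ht a.le_succ)).symm
    have hC : MeasurableSet[𝓖 (t a)]
        (⋂ i ∈ S, (fun ω => X (t (i + 1)) ω - X (t i) ω) ⁻¹' sets i) := by
      refine Finset.measurableSet_biInter _ fun i hi => ?_
      refine Measurable.sub ?_ ?_ (hs i (Finset.mem_insert_of_mem hi))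
      · exact (hX.measurable _).mono (𝓖.mono (ht (ha i hi))) le_rfl
      · exact (hX.measurable _).mono (𝓖.mono (ht (ha i hi).le)) le_rfl
    have hsa := hs a (Finset.mem_insert_self a S)
    rw [Finset.prod_insert fun h => (ha a h).false, Finset.set_biInter_insert, Set.inter_comm,
      ← ih fun i hi => hs i (Finset.mem_insert_of_mem hi), mul_comm, e]
    rw [hX.measure_inter _ _ _ _ hC hsa, hX.measure_preimage _ _ hsa]

lemma isPreBrownianReal [IsProbabilityMeasure P] (hX : HasGaussianIncrementsWrt 𝓖 X P)
    (h0 : ∀ ω, X 0 ω = 0) : IsPreBrownianReal X P := by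
  refine HasIndepIncrements.isPreBrownianReal_of_hasLaw (fun t => ?_) hX.hasIndepIncrements
  refine ⟨(hX.measurable' t).aemeasurable, Measure.ext fun S hS => ?_⟩
  rw [Measure.map_apply (hX.measurable' t) hS]
  simpa [h0] using hX.measure_preimage 0 t hS

/-- Conditioning on an initial event leaves the increment laws unchanged. For the shifted filtration
the initial events are those of the past of `τ`, so this turns equality of laws into independence.
-/
lemma cond [IsProbabilityMeasure P] (hX : HasGaussianIncrementsWrt 𝓖 X P) {A : Set Ω}
    (hA : MeasurableSet[𝓖 0] A) : HasGaussianIncrementsWrt 𝓖 X P[|A] where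
  measurable := hX.measurable
  measure_inter s h C S hC hS := by
    have hA' := 𝓖.le 0 _ hA
    rw [cond_apply hA', cond_apply hA', ← Set.inter_assoc,
      hX.measure_inter s h _ S ((𝓖.mono (zero_le) _ hA).inter hC) hS, mul_assoc]

end HasGaussianIncrementsWrt

/-- A stopping time shifted by a constant. -/
lemma isStoppingTime_coe_add {τ : Ω → ℝ≥0} (hτ : IsStoppingTime 𝓖 fun ω => (τ ω : WithTop ℝ≥0))
    (t : ℝ≥0) : IsStoppingTime 𝓖 fun ω => ((τ ω + t : ℝ≥0) : WithTop ℝ≥0) := by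
  intro i
  by_cases hti : t ≤ i
  · convert 𝓖.mono (tsub_le_self : i - t ≤ i) _ (hτ (i - t)) using 1
    ext ω
    simp only [Set.mem_ofPred_eq, WithTop.coe_le_coe]
    exact (le_tsub_iff_right hti).symm
  · convert @MeasurableSet.empty _ (𝓖 i) using 1
    ext ω
    simp only [Set.mem_ofPred_eq, WithTop.coe_le_coe, Set.mem_empty_iff_false, iff_false]
    exact fun h => hti (le_of_add_le_right h)

/-- The filtration `t ↦ 𝓖_{τ + t}`. -/
def shiftedFiltration {τ : Ω → ℝ≥0} (hτ : IsStoppingTime 𝓖 fun ω => (τ ω : WithTop ℝ≥0)) :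
    Filtration ℝ≥0 mΩ where
  seq t := (isStoppingTime_coe_add hτ t).measurableSpace
  mono' _ _ h := IsStoppingTime.measurableSpace_mono _ _ fun _ =>
    WithTop.coe_le_coe.2 (add_le_add_right h _)
  le' _ := IsStoppingTime.measurableSpace_le _

lemma measurableSpace_shiftedFiltration_zero {τ : Ω → ℝ≥0}
    (hτ : IsStoppingTime 𝓖 fun ω => (τ ω : WithTop ℝ≥0)) :
    shiftedFiltration hτ 0 = hτ.measurableSpace :=
  le_antisymm
    (IsStoppingTime.measurableSpace_mono (isStoppingTime_coe_add hτ 0) hτ fun _ => WithTop.coe_le_coe.2 (add_zero _).le)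
    (IsStoppingTime.measurableSpace_mono hτ (isStoppingTime_coe_add hτ 0) fun _ =>
      WithTop.coe_le_coe.2 (add_zero _).ge)

lemma measurable_eval_of_continuous (hc : ∀ ω, Continuous (X · ω)) (hX : ∀ t, Measurable (X t))
    {σ : Ω → ℝ≥0} (hσ : Measurable σ) : Measurable fun ω => X (σ ω) ω :=
  (measurable_uncurry_of_continuous_of_measurable hc hX).comp (hσ.prodMk measurable_id)

/-- Approximation of `σ` from above by a function with values in a grid of width `1 / (n + 1)`. -/
noncomputable def gridAbove (σ : Ω → ℝ≥0) (n : ℕ) (ω : Ω) : ℝ≥0 :=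
  (⌊((n : ℝ≥0) + 1) * σ ω⌋₊ + 1) / ((n : ℝ≥0) + 1)

lemma tendsto_gridAbove (σ : Ω → ℝ≥0) (ω : Ω) :
    Tendsto (fun n => gridAbove σ n ω) atTop (𝓝 (σ ω)) := by
  have h1 : Tendsto (fun n : ℕ => σ ω + 1 / ((n : ℝ≥0) + 1)) atTop (𝓝 (σ ω)) := by
    have : Tendsto (fun n : ℕ => 1 / ((n : ℝ≥0) + 1)) atTop (𝓝 0) := by
      rw [← NNReal.tendsto_coe]
      simpa using tendsto_one_div_add_atTop_nhds_zero_nat (𝕜 := ℝ)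
    simpa using tendsto_const_nhds.add this
  refine tendsto_of_tendsto_of_tendsto_of_le_of_le tendsto_const_nhds h1 (fun n => ?_) fun n => ?_
  · have hn : (0 : ℝ≥0) < n + 1 := by positivity
    rw [gridAbove, le_div_iff₀ hn, mul_comm]
    exact (Nat.lt_floor_add_one _).le
  · have hn : (0 : ℝ≥0) < n + 1 := by positivity
    rw [gridAbove, div_le_iff₀ hn, add_mul (σ ω), one_div, inv_mul_cancel₀ hn.ne',
      mul_comm (σ ω)]
    gcongr
    exact Nat.floor_le (zero_le)

lemma measurable_gridAbove {σ : Ω → ℝ≥0} (hσ : Measurable σ) (n : ℕ) :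
    Measurable (gridAbove σ n) := by
  have : Measurable fun ω => ⌊((n : ℝ≥0) + 1) * σ ω⌋₊ :=
    Nat.measurable_floor.comp (hσ.const_mul _)
  exact ((measurable_from_nat.comp this).add_const 1).div_const _

lemma measurable_of_isStoppingTime_coe {σ : Ω → ℝ≥0}
    (hσ : IsStoppingTime 𝓖 fun ω => (σ ω : WithTop ℝ≥0)) : Measurable σ :=
  measurable_of_Iic fun i => by
    simp only [IsStoppingTime, WithTop.coe_le_coe] at hσ
    exact 𝓖.le i _ (hσ i)

namespace HasGaussianIncrementsWrt

/-- Where the grid time equals a constant `q`, the claim is the increment property at `q`; summing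
over the countably many grid values gives the result. -/
lemma measure_inter_gridAbove (hX : HasGaussianIncrementsWrt 𝓖 X P)
    (hc : ∀ ω, Continuous (X · ω)) {σ : Ω → ℝ≥0}
    (hσ : IsStoppingTime 𝓖 fun ω => (σ ω : WithTop ℝ≥0)) (h : ℝ≥0) {C : Set Ω} {S : Set ℝ}
    (hC : MeasurableSet[hσ.measurableSpace] C) (hS : MeasurableSet S) (n : ℕ) :
    P (C ∩ (fun ω => X (gridAbove σ n ω + h) ω - X (gridAbove σ n ω) ω) ⁻¹' S) =
      P C * gaussianReal 0 h S := by
  have hn : (0 : ℝ≥0) < n + 1 := by positivity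
  have hσm := measurable_of_isStoppingTime_coe hσ
  set N : Ω → ℕ := fun ω => ⌊((n : ℝ≥0) + 1) * σ ω⌋₊
  have hN : Measurable N := Nat.measurable_floor.comp (hσm.const_mul _)
  have hCm : MeasurableSet C := hσ.measurableSpace_le _ hC
  have split : ∀ E, MeasurableSet E → P E = ∑' k, P (E ∩ N ⁻¹' {k}) := by
    intro E hE
    rw [← measure_iUnion _ fun k => hE.inter (hN (measurableSet_singleton k)), ← Set.inter_iUnion,
      ← Set.preimage_iUnion]
    · simp [Set.iUnion_of_singleton]
    · intro i j hij
      refine Set.disjoint_left.2 fun ω hi hj => hij ?_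
      exact (Set.mem_singleton_iff.1 hi.2).symm.trans (Set.mem_singleton_iff.1 hj.2)
  have hΔ : Measurable fun ω => X (gridAbove σ n ω + h) ω - X (gridAbove σ n ω) ω := by
    have hg := measurable_gridAbove hσm n
    exact (measurable_eval_of_continuous hc hX.measurable' (hg.add_const h)).sub
      (measurable_eval_of_continuous hc hX.measurable' hg)
  rw [split _ (hCm.inter (hΔ hS)), split C hCm, ← ENNReal.tsum_mul_right]
  refine tsum_congr fun k => ?_
  set q : ℝ≥0 := (k + 1) / (n + 1)
  have hCk : MeasurableSet[𝓖 q] (C ∩ N ⁻¹' {k}) := by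
    -- The event `N = k` says `k / (n + 1) ≤ σ < q`. Adding the redundant condition `σ ≤ q` exposes
    -- `C ∩ {σ ≤ q}`, which lies in `𝓖 q`.
    have e : C ∩ N ⁻¹' {k} = (C ∩ {ω | (σ ω : WithTop ℝ≥0) ≤ q}) ∩
        ({ω | (σ ω : WithTop ℝ≥0) < q} ∩
          {ω | (σ ω : WithTop ℝ≥0) < ((k / (n + 1) : ℝ≥0) : WithTop ℝ≥0)}ᶜ) := by
      ext ω
      have : N ω = k ↔ k / (n + 1) ≤ σ ω ∧ σ ω < q := by
        simp only [N, q]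
        rw [Nat.floor_eq_iff (zero_le), div_le_iff₀ hn, lt_div_iff₀ hn, mul_comm]
      simp only [Set.mem_inter_iff, Set.mem_preimage, Set.mem_singleton_iff, this,
        Set.mem_ofPred_eq, Set.mem_compl_iff, WithTop.coe_le_coe, WithTop.coe_lt_coe, not_lt]
      exact ⟨fun h => ⟨⟨h.1, h.2.2.le⟩, h.2.2, h.2.1⟩, fun h => ⟨h.1.1, h.2.2, h.2.1⟩⟩
    rw [e]
    refine (hC.2 q).inter ((hσ.measurableSet_lt q).inter (MeasurableSet.compl ?_))
    refine 𝓖.mono ?_ _ (hσ.measurableSet_lt _)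
    simp only [q]
    gcongr
    exact le_self_add
  rw [← hX.measure_inter q h _ S hCk hS]
  congr 1
  ext ω
  simp only [Set.mem_inter_iff, Set.mem_preimage, Set.mem_singleton_iff]
  constructor
  · rintro ⟨⟨h1, h2⟩, h3⟩
    have : gridAbove σ n ω = q := by simp only [gridAbove, q, ← h3, N]
    exact ⟨⟨h1, h3⟩, by rwa [this] at h2⟩
  · rintro ⟨⟨h1, h3⟩, h2⟩
    have : gridAbove σ n ω = q := by simp only [gridAbove, q, ← h3, N]
    exact ⟨⟨h1, by rwa [this]⟩, h3⟩

lemma measure_inter_stoppingTime [IsProbabilityMeasure P] (hX : HasGaussianIncrementsWrt 𝓖 X P)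
    (hc : ∀ ω, Continuous (X · ω)) {σ : Ω → ℝ≥0}
    (hσ : IsStoppingTime 𝓖 fun ω => (σ ω : WithTop ℝ≥0)) (h : ℝ≥0) {C : Set Ω} {S : Set ℝ}
    (hC : MeasurableSet[hσ.measurableSpace] C) (hS : MeasurableSet S) :
    P (C ∩ (fun ω => X (σ ω + h) ω - X (σ ω) ω) ⁻¹' S) = P C * gaussianReal 0 h S := by
  have hσm := measurable_of_isStoppingTime_coe hσ
  have hinc : ∀ {ρ : Ω → ℝ≥0}, Measurable ρ → Measurable fun ω => X (ρ ω + h) ω - X (ρ ω) ω :=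
    fun hρ => (measurable_eval_of_continuous hc hX.measurable' (hρ.add_const h)).sub
      (measurable_eval_of_continuous hc hX.measurable' hρ)
  have hgrid := fun n => hinc (measurable_gridAbove hσm n)
  have hmap : ∀ n, (P.restrict C).map
      (fun ω => X (gridAbove σ n ω + h) ω - X (gridAbove σ n ω) ω) = P C • gaussianReal 0 h := by
    intro n
    refine Measure.ext fun S hS => ?_
    rw [Measure.map_apply (hgrid n) hS, Measure.restrict_apply (hgrid n hS), Set.inter_comm,
      hX.measure_inter_gridAbove hc hσ h hC hS n, Measure.smul_apply, smul_eq_mul]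
  have : IsFiniteMeasure (P C • gaussianReal 0 h) := hmap 0 ▸ inferInstance
  -- Path continuity makes the grid increments converge pointwise; bounded continuous test functions
  -- carry the constant law to the limit.
  have key : (P.restrict C).map (fun ω => X (σ ω + h) ω - X (σ ω) ω) =
      P C • gaussianReal 0 h := by
    refine ext_of_forall_integral_eq_of_IsFiniteMeasure fun F => ?_
    have hF := F.continuous
    rw [integral_map (hinc hσm).aemeasurable hF.aestronglyMeasurable]
    refine tendsto_nhds_unique (f := fun n => ∫ ω, F (X (gridAbove σ n ω + h) ω -
      X (gridAbove σ n ω) ω) ∂(P.restrict C)) (l := atTop) ?_ ?_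
    · refine tendsto_integral_of_dominated_convergence (fun _ => ‖F‖) (fun n => ?_)
        (integrable_const _) (fun n => ae_of_all _ fun ω => F.norm_coe_le_norm _)
        (ae_of_all _ fun ω => ?_)
      · exact (hF.measurable.comp (hgrid n)).aestronglyMeasurable
      · have hg := tendsto_gridAbove σ ω
        exact (hF.tendsto _).comp ((((hc ω).tendsto _).comp (hg.add_const h)).sub
          (((hc ω).tendsto _).comp hg))
    · refine tendsto_const_nhds.congr fun n => ?_
      rw [← hmap n, integral_map (hgrid n).aemeasurable hF.aestronglyMeasurable]
  rw [Set.inter_comm, ← Measure.restrict_apply (hinc hσm hS), ← Measure.map_apply (hinc hσm) hS,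
    key, Measure.smul_apply, smul_eq_mul]

lemma measurable_stoppedValue_coe (hX : HasGaussianIncrementsWrt 𝓖 X P)
    (hc : ∀ ω, Continuous (X · ω)) {σ : Ω → ℝ≥0}
    (hσ : IsStoppingTime 𝓖 fun ω => (σ ω : WithTop ℝ≥0)) :
    Measurable[hσ.measurableSpace] fun ω => X (σ ω) ω := by
  have hadapted : StronglyAdapted 𝓖 X := fun t => (hX.measurable t).stronglyMeasurable
  exact measurable_stoppedValue (hadapted.isStronglyProgressive_of_continuous hc) hσ

/-- The strong Markov property: increments after a stopping time. -/
lemma shift [IsProbabilityMeasure P] (hX : HasGaussianIncrementsWrt 𝓖 X P)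
    (hc : ∀ ω, Continuous (X · ω)) {τ : Ω → ℝ≥0}
    (hτ : IsStoppingTime 𝓖 fun ω => (τ ω : WithTop ℝ≥0)) :
    HasGaussianIncrementsWrt (shiftedFiltration hτ) (fun t ω => X (t + τ ω) ω - X (τ ω) ω) P where
  measurable t := by
    have h1 := hX.measurable_stoppedValue_coe hc (isStoppingTime_coe_add hτ t)
    have h2 := (hX.measurable_stoppedValue_coe hc hτ).mono
      (IsStoppingTime.measurableSpace_mono hτ (isStoppingTime_coe_add hτ t)
        fun _ => WithTop.coe_le_coe.2 le_self_add) le_rfl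
    simp only [add_comm t]
    exact Measurable.sub h1 h2
  measure_inter s h C S hC hS := by
    have := hX.measure_inter_stoppingTime hc (isStoppingTime_coe_add hτ s) h hC hS
    rw [← this]
    congr 2
    ext ω
    simp only [sub_sub_sub_cancel_right, add_comm, add_left_comm]

end HasGaussianIncrementsWrt

lemma map_path_eq_of_isPreBrownianReal {Ω' : Type*} {mΩ' : MeasurableSpace Ω'} {P' : Measure Ω'}
    {Y : ℝ≥0 → Ω' → ℝ} (hX : IsPreBrownianReal X P) (hY : IsPreBrownianReal Y P')
    (hXm : ∀ t, Measurable (X t)) (hYm : ∀ t, Measurable (Y t)) :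
    P.map (fun ω t => X t ω) = P'.map (fun ω t => Y t ω) := by
  have h1 := isProjectiveLimit_map (P := P) (X := X) (measurable_pi_lambda _ hXm).aemeasurable
  have h2 := isProjectiveLimit_map (P := P') (X := Y) (measurable_pi_lambda _ hYm).aemeasurable
  simp only [(hX.hasLaw _).map_eq] at h1
  simp only [(hY.hasLaw _).map_eq] at h2
  exact h1.unique h2

/-- The strong Markov property: the process after a stopping time is independent of the past. -/
lemma HasGaussianIncrementsWrt.indep_shift [IsProbabilityMeasure P]
    (hX : HasGaussianIncrementsWrt 𝓖 X P) (hc : ∀ ω, Continuous (X · ω)) {τ : Ω → ℝ≥0}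
    (hτ : IsStoppingTime 𝓖 fun ω => (τ ω : WithTop ℝ≥0)) :
    Indep (MeasurableSpace.comap (fun ω t => X (t + τ ω) ω - X (τ ω) ω) inferInstance)
      hτ.measurableSpace P := by
  have hY := hX.shift hc hτ
  have hYm := measurable_pi_lambda _ hY.measurable'
  rw [Indep_iff]
  rintro _ A ⟨S, hS, rfl⟩ hA
  by_cases h0 : P A = 0
  · rw [h0, mul_zero]
    exact measure_mono_null Set.inter_subset_right h0
  have hAm : MeasurableSet A := hτ.measurableSpace_le _ hA
  have := cond_isProbabilityMeasure h0
  rw [← measurableSpace_shiftedFiltration_zero] at hA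
  -- The shifted process is pre-Brownian both under `P` and given `A`, so its path law does not
  -- depend on the conditioning.
  have e := map_path_eq_of_isPreBrownianReal (hY.isPreBrownianReal (by simp))
    ((hY.cond hA).isPreBrownianReal (by simp)) hY.measurable' hY.measurable'
  have e := congrArg (fun μ => μ S) e
  simp only [Measure.map_apply hYm hS] at e
  rw [e, cond_apply hAm, mul_comm, ← mul_assoc, ENNReal.mul_inv_cancel h0 (measure_ne_top _ _),
    one_mul, Set.inter_comm]

end StrongMarkov

/-! ### Transfer to SLE and treatment of null sets -/

section Assembly

variable {Ω : Type*} {mΩ : MeasurableSpace Ω} {P : Measure Ω} {𝓖 : Filtration ℝ≥0 mΩ}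
  {B : ℝ≥0 → Ω → ℝ}

lemma measurable_sleFlow (κ : ℝ) (hc : ∀ ω, Continuous (B · ω)) (hB : ∀ t, Measurable (B t)) :
    Measurable fun ω (t : ℝ≥0) => sleFlow κ B t ω :=
  measurable_pi_lambda _ fun t => measurable_pi_lambda _ fun z =>
    measurable_loewnerMap (X := fun s ω => √κ * B s ω) (fun ω => (hc ω).const_mul _)
      (fun s => (hB s).const_mul _) t z

/-- The flow is known to be a measurable functional only on continuous paths, so equality of path
laws is first transported to that subtype. -/
lemma identDistrib_sleFlow (κ : ℝ) {Ω' : Type*} {mΩ' : MeasurableSpace Ω'} {P' : Measure Ω'}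
    {B' : ℝ≥0 → Ω' → ℝ} (hB : IsPreBrownianReal B P) (hB' : IsPreBrownianReal B' P')
    (hc : ∀ ω, Continuous (B · ω)) (hc' : ∀ ω, Continuous (B' · ω))
    (hm : ∀ t, Measurable (B t)) (hm' : ∀ t, Measurable (B' t)) :
    IdentDistrib (fun ω (t : ℝ≥0) => sleFlow κ B t ω) (fun ω (t : ℝ≥0) => sleFlow κ B' t ω)
      P P' := by
  have hpath := map_path_eq_of_isPreBrownianReal hB hB' hm hm'
  have hW : Measurable fun ω => (⟨fun t => B t ω, hc ω⟩ : {f : ℝ≥0 → ℝ // Continuous f}) :=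
    (measurable_pi_lambda _ hm).subtype_mk
  have hW' : Measurable fun ω => (⟨fun t => B' t ω, hc' ω⟩ : {f : ℝ≥0 → ℝ // Continuous f}) :=
    (measurable_pi_lambda _ hm').subtype_mk
  have h : IdentDistrib (fun ω => (⟨fun t => B t ω, hc ω⟩ : {f : ℝ≥0 → ℝ // Continuous f}))
      (fun ω => (⟨fun t => B' t ω, hc' ω⟩ : {f : ℝ≥0 → ℝ // Continuous f})) P P' := by
    refine ⟨hW.aemeasurable, hW'.aemeasurable, Measure.ext ?_⟩
    rintro _ ⟨S, hS, rfl⟩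
    rw [Measure.map_apply hW (measurable_subtype_coe hS),
      Measure.map_apply hW' (measurable_subtype_coe hS)]
    have := congrArg (fun μ => μ S) hpath
    simp only [Measure.map_apply (measurable_pi_lambda _ hm) hS,
      Measure.map_apply (measurable_pi_lambda _ hm') hS] at this
    exact this
  exact h.comp (measurable_sleFlow κ (B := fun t (f : {f : ℝ≥0 → ℝ // Continuous f}) => f.1 t)
    (fun f => f.2) fun t => (measurable_pi_apply t).comp measurable_subtype_coe)

lemma measurable_sleHistory_of_clippedFlow {Ω : Type*} {m : MeasurableSpace Ω} {κ : ℝ}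
    {B : ℝ≥0 → Ω → ℝ} {τ : Ω → ℝ≥0} (hc : ∀ ω, Continuous (B · ω))
    (hτ : Measurable fun ω => (τ ω : WithTop ℝ≥0))
    (h : ∀ ε > 0, ∀ t z, Measurable fun ω => clippedFlow ε (fun s => √κ * B s ω) z (min t (τ ω))) :
    Measurable (sleHistory κ B fun ω => (τ ω : WithTop ℝ≥0)) :=
  hτ.prodMk (measurable_pi_lambda _ fun t => measurable_pi_lambda _ fun z =>
    measurable_loewnerMap_of_clippedFlow (X := fun s ω => √κ * B s ω)
      (T := fun ω => min t (τ ω)) (fun ω => (hc ω).const_mul _) fun ε hε => h ε hε t z)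

lemma measurable_sleHistory (κ : ℝ) (hc : ∀ ω, Continuous (B · ω))
    (hB : ∀ t, Measurable[𝓖 t] (B t)) {τ : Ω → ℝ≥0}
    (hτ : IsStoppingTime 𝓖 fun ω => (τ ω : WithTop ℝ≥0)) :
    Measurable[hτ.measurableSpace] (sleHistory κ B fun ω => (τ ω : WithTop ℝ≥0)) := by
  have hc' : ∀ ω, Continuous fun s => √κ * B s ω := fun ω => (hc ω).const_mul _
  refine measurable_sleHistory_of_clippedFlow hc hτ.measurable fun ε hε t z => ?_
  -- The clipped flow is continuous in time and defined everywhere, so adaptedness makes it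
  -- progressive and its value at `min t τ` is measurable in the past of `τ`.
  have hadapted : StronglyAdapted 𝓖 fun t ω => clippedFlow ε (fun s => √κ * B s ω) z t :=
    fun t => (measurable_clippedFlow (m := 𝓖 t) (X := fun s ω => √κ * B s ω) hc'
      (fun s hs => ((hB s).mono (𝓖.mono hs) le_rfl).const_mul _) hε z).stronglyMeasurable
  have hmin : IsStoppingTime 𝓖 fun ω => ((min t (τ ω) : ℝ≥0) : WithTop ℝ≥0) := by
    have e : (fun ω => ((min t (τ ω) : ℝ≥0) : WithTop ℝ≥0)) = fun ω => min (τ ω : WithTop ℝ≥0) t :=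
      funext fun ω => by rw [min_comm, WithTop.coe_min]
    exact e ▸ hτ.min_const t
  have := measurable_stoppedValue (hadapted.isStronglyProgressive_of_continuous
    fun ω => continuous_clippedFlow hε (hc' ω) z) hmin
  exact this.mono (IsStoppingTime.measurableSpace_mono hmin hτ
    fun ω => WithTop.coe_le_coe.2 (min_le_right _ _)) le_rfl

lemma shiftedSLE_eq_sleFlow (κ : ℝ) (τ : Ω → WithTop ℝ≥0) (t : ℝ≥0) {ω : Ω}
    (hc : Continuous (B · ω)) : shiftedSLE κ B τ t ω =
      sleFlow κ (fun t ω => B (t + (τ ω).untopD 0) ω - B ((τ ω).untopD 0) ω) t ω := by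
  funext z
  have := loewnerMap_shift (hc.const_mul √κ) ((τ ω).untopD 0) t z
  simp only [← mul_sub] at this
  exact this

/-- The strong Markov property of SLE when the driving process has continuous paths and the
stopping time is finite. -/
lemma strongMarkov_sle [IsProbabilityMeasure P] (κ : ℝ) (hB : HasGaussianIncrementsWrt 𝓖 B P)
    (hB0 : IsPreBrownianReal B P) (hc : ∀ ω, Continuous (B · ω)) {τ : Ω → ℝ≥0}
    (hτ : IsStoppingTime 𝓖 fun ω => (τ ω : WithTop ℝ≥0)) :
    IsChordalSLE κ (shiftedSLE κ B fun ω => (τ ω : WithTop ℝ≥0)) P ∧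
    IdentDistrib (fun ω (t : ℝ≥0) => shiftedSLE κ B (fun ω => (τ ω : WithTop ℝ≥0)) t ω)
      (fun ω (t : ℝ≥0) => sleFlow κ B t ω) P P ∧
    IndepFun (fun ω (t : ℝ≥0) => shiftedSLE κ B (fun ω => (τ ω : WithTop ℝ≥0)) t ω)
      (sleHistory κ B fun ω => (τ ω : WithTop ℝ≥0)) P := by
  have hY := hB.shift hc hτ
  have hYc : ∀ ω, Continuous fun t => B (t + τ ω) ω - B (τ ω) ω := fun ω =>
    ((hc ω).comp (continuous_add_const _)).sub continuous_const
  have hYB := hY.isPreBrownianReal (by simp)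
  have e : shiftedSLE κ B (fun ω => (τ ω : WithTop ℝ≥0)) =
      sleFlow κ fun t ω => B (t + τ ω) ω - B (τ ω) ω :=
    funext fun t => funext fun ω => shiftedSLE_eq_sleFlow κ _ t (hc ω)
  rw [e]
  refine ⟨⟨_, ⟨hYB, ae_of_all _ hYc⟩, ae_of_all _ fun ω t => rfl⟩, ?_, ?_⟩
  · exact identDistrib_sleFlow κ hYB hB0 hYc hc hY.measurable' hB.measurable'
  · rw [IndepFun_iff_Indep]
    refine indep_of_indep_of_le_left (indep_of_indep_of_le_right (hB.indep_shift hc hτ) ?_) ?_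
    · exact (measurable_sleHistory κ hc hB.measurable hτ).comap_le
    · refine (measurable_sleFlow κ hYc fun t => ?_).comap_le
      exact (measurable_pi_apply t).comp (comap_measurable fun ω t => B (t + τ ω) ω - B (τ ω) ω)

/-- The filtration `𝓖` augmented by all measurable null sets. -/
def augmentedFiltration (𝓖 : Filtration ℝ≥0 mΩ) (P : Measure Ω) : Filtration ℝ≥0 mΩ where
  seq t := eventuallyMeasurableSpace (𝓖 t) (ae P) ⊓ mΩ
  mono' _ _ h := inf_le_inf_right _ fun _ ⟨t, ht, e⟩ => ⟨t, 𝓖.mono h _ ht, e⟩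
  le' _ := inf_le_right

lemma measurableSet_augmentedFiltration_iff {t : ℝ≥0} {s : Set Ω} :
    MeasurableSet[augmentedFiltration 𝓖 P t] s ↔
      (∃ s', MeasurableSet[𝓖 t] s' ∧ s =ᵐ[P] s') ∧ MeasurableSet s :=
  MeasurableSpace.measurableSet_inf

/-- A null modification of `B` need not be adapted to `𝓖`, but is adapted to the augmentation;
independence survives because the events involved change only by null sets. -/
lemma IsBrownianWrt.hasGaussianIncrementsWrt_augmented (hB : IsBrownianWrt 𝓖 B P)
    {B' : ℝ≥0 → Ω → ℝ} (hB' : ∀ t, Measurable (B' t)) (h : ∀ t, B' t =ᵐ[P] B t) :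
    HasGaussianIncrementsWrt (augmentedFiltration 𝓖 P) B' P where
  measurable t S hS := measurableSet_augmentedFiltration_iff.2
    ⟨⟨B t ⁻¹' S, hB.adapted t hS, (h t).preimage S⟩, hB' t hS⟩
  measure_inter s r C S hC hS := by
    obtain ⟨⟨C', hC', e⟩, -⟩ := measurableSet_augmentedFiltration_iff.1 hC
    have hinc : (fun ω => B' (s + r) ω - B' s ω) =ᵐ[P] fun ω => B (s + r) ω - B s ω :=
      (h _).sub (h _)
    rw [measure_congr (e.inter (hinc.preimage S)), measure_congr e, Set.inter_comm,
      (Indep_iff _ _ _).1 (hB.indep_increment s (s + r) le_self_add) _ _ ⟨S, hS, rfl⟩ hC', mul_comm]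
    congr 1
    have hlaw := hB.isBrownian.hasLaw_sub (s + r) s
    have hd : nndist ((s + r : ℝ≥0) : ℝ) s = r := by
      apply NNReal.eq
      rw [coe_nndist, Real.dist_eq, NNReal.coe_add, add_sub_cancel_left, abs_of_nonneg r.coe_nonneg]
    have hd' : nndist (s + r).1 s.1 = r := hd
    rw [hd'] at hlaw
    rw [← hlaw.map_eq, Measure.map_apply_of_aemeasurable hlaw.aemeasurable hS]
    rfl

end Assembly

theorem mainTheorem10 {Ω : Type*} [mΩ : MeasurableSpace Ω] (P : Measure Ω)
    (κ : ℝ) (hκ : 0 < κ)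
    (𝓕 : Filtration ℝ≥0 mΩ) (B : ℝ≥0 → Ω → ℝ) (hB : IsBrownianWrt 𝓕 B P)
    (τ : Ω → WithTop ℝ≥0) (hτ : IsStoppingTime 𝓕 τ) (hτ_fin : ∀ᵐ ω ∂P, τ ω ≠ ⊤) :
    IsChordalSLE κ (shiftedSLE κ B τ) P ∧
    IdentDistrib (fun ω (t : ℝ≥0) => shiftedSLE κ B τ t ω)
      (fun ω (t : ℝ≥0) => sleFlow κ B t ω) P P ∧
    IndepFun (fun ω (t : ℝ≥0) => shiftedSLE κ B τ t ω) (sleHistory κ B τ) P := by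
  classical
  have : IsProbabilityMeasure P := hB.isBrownian.isGaussianProcess.isProbabilityMeasure
  -- Off the measurable null set `N`, paths are continuous and `τ` is finite. On `N` both are
  -- replaced by zero.
  obtain ⟨N, hNsub, hN, hN0⟩ :=
    exists_measurable_superset_of_null (ae_iff.1 (hB.isBrownian.cont.and hτ_fin))
  have hgood : ∀ ω ∉ N, Continuous (B · ω) ∧ τ ω ≠ ⊤ := fun ω hω => by
    by_contra h
    exact hω (hNsub h)
  have hNae : ∀ᵐ ω ∂P, ω ∉ N := measure_eq_zero_iff_ae_notMem.1 hN0
  set B' : ℝ≥0 → Ω → ℝ := fun t ω => if ω ∈ N then 0 else B t ω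
  set τ' : Ω → ℝ≥0 := fun ω => if ω ∈ N then 0 else (τ ω).untopD 0
  have hBB' : ∀ ω ∉ N, (B' · ω) = (B · ω) := fun ω hω => funext fun t => if_neg hω
  have hττ' : ∀ ω ∉ N, (τ' ω : WithTop ℝ≥0) = τ ω := fun ω hω => by
    simp only [τ', if_neg hω]
    lift τ ω to ℝ≥0 using (hgood ω hω).2 with s
    rfl
  have hc' : ∀ ω, Continuous (B' · ω) := fun ω => by
    by_cases hω : ω ∈ N
    · simp only [B', if_pos hω]
      exact continuous_const
    · rw [hBB' ω hω]
      exact (hgood ω hω).1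
  have hB'ae : ∀ t, B' t =ᵐ[P] B t := fun t => hNae.mono fun ω hω => congrFun (hBB' ω hω) t
  have hB'm : ∀ t, Measurable (B' t) := fun t =>
    Measurable.ite hN measurable_const ((hB.adapted t).mono (𝓕.le t) le_rfl)
  have hτ's : IsStoppingTime (augmentedFiltration 𝓕 P) fun ω => (τ' ω : WithTop ℝ≥0) := by
    refine fun i => measurableSet_augmentedFiltration_iff.2 ⟨⟨_, hτ i, ?_⟩, ?_⟩
    · filter_upwards [hNae] with ω hω
      have : (τ' ω : WithTop ℝ≥0) ≤ i ↔ τ ω ≤ i := by rw [hττ' ω hω]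
      exact propext this
    -- Since `τ'` vanishes on `N`, the event `τ' ≤ i` is `N ∪ {τ ≤ i}`.
    · convert hN.union (𝓕.le i _ (hτ i)) using 1
      ext ω
      by_cases hω : ω ∈ N
      · have : (τ' ω : WithTop ℝ≥0) ≤ i := by
          rw [WithTop.coe_le_coe]
          simp [τ', hω]
        exact ⟨fun _ => Or.inl hω, fun _ => this⟩
      · have : (τ' ω : WithTop ℝ≥0) ≤ i ↔ τ ω ≤ i := by rw [hττ' ω hω]
        exact this.trans ⟨Or.inr, fun h => h.resolve_left hω⟩
  obtain ⟨⟨W, hW, hSLE⟩, hid, hind⟩ := strongMarkov_sle κ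
    (hB.hasGaussianIncrementsWrt_augmented hB'm hB'ae)
    (hB.isBrownian.toIsPreBrownianReal.congr fun t => (hB'ae t).symm) hc' hτ's
  have hflow : ∀ ω ∉ N, ∀ t, sleFlow κ B' t ω = sleFlow κ B t ω := fun ω hω t => by
    simp only [sleFlow, congrFun (hBB' ω hω)]
  have hshift : ∀ ω ∉ N, ∀ t,
      shiftedSLE κ B' (fun ω => (τ' ω : WithTop ℝ≥0)) t ω = shiftedSLE κ B τ t ω := by
    intro ω hω t
    funext z
    simp only [shiftedSLE, hflow ω hω, congrFun (hBB' ω hω), hττ' ω hω]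
  have hshift_ae : (fun ω (t : ℝ≥0) => shiftedSLE κ B' (fun ω => (τ' ω : WithTop ℝ≥0)) t ω)
      =ᵐ[P] fun ω (t : ℝ≥0) => shiftedSLE κ B τ t ω :=
    hNae.mono fun ω hω => funext (hshift ω hω)
  have hflow_ae : (fun ω (t : ℝ≥0) => sleFlow κ B' t ω) =ᵐ[P] fun ω t => sleFlow κ B t ω :=
    hNae.mono fun ω hω => funext (hflow ω hω)
  refine ⟨⟨W, hW, ?_⟩, ?_, hind.congr hshift_ae ?_⟩
  · filter_upwards [hSLE, hNae] with ω h hω t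
    rw [← hshift ω hω, h]
  · exact ((IdentDistrib.of_ae_eq hid.aemeasurable_fst hshift_ae).symm.trans hid).trans
      (IdentDistrib.of_ae_eq hid.aemeasurable_snd hflow_ae)
  · refine hNae.mono fun ω hω => ?_
    simp only [sleHistory, hττ' ω hω, hflow ω hω]
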